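/- Let $A$ be a (possibly unbounded) self-adjoint operator on a complex Hilbert space $\mathscr H$, let $c>0$, and let $\Omega := \{x+iy : x,y\in\mathbb R,\ 0<|y|\le c\langle x\rangle\}$, where $\langle x\rangle := \sqrt{1+x^2}$. Let $\log_0(x):=1$, $\log_1(x):=\log(1+x)$ and $\log_k(x):=\log(1+\log_{k-1}(x))$ for $k\ge 2$, and write $\log_k^p(x):=(\log_k(x))^p$. Functions of $A$ are defined by the functional calculus, and products of unbounded operators have their natural domains. Let $0<s<1$. (1) For every $p\in\mathbb R$ there is $C>0$ such that for all $z=x+iy\in\Omega$ the operator $\log^p(1+\langle A\rangle)\,\langle A\rangle^s (A-z)^{-1}$ is defined on all of $\mathscr H$, bounded, and $$\big\|\log^p(1+\langle A\rangle)\,\langle A\rangle^s (A-z)^{-1}\big\| \le C\,\log^p(1+\langle x\rangle)\,\langle x\rangle^s\,|y|^{-1}.$$ (2) For every integer $m\ge 0$ and all $p,q\in\mathbb R$ there is $C>0$ such that for all $z=x+iy\in\Omega$ the operator $\langle A\rangle^s (A-z)^{-1}\log_{m+1}^p(\langle A\rangle)\prod_{k=0}^m\log_k^q(\langle A\rangle)$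 is densely defined and bounded on its domain (so it extends uniquely to a bounded operator on $\mathscr H$), and $$\Big\|\langle A\rangle^s (A-z)^{-1}\log_{m+1}^p(\langle A\rangle)\prod_{k=0}^m\log_k^q(\langle A\rangle)\Big\| \le C\,\langle x\rangle^s\,|y|^{-1}\log_{m+1}^p(\langle x\rangle)\prod_{k=0}^m\log_k^q(\langle x\rangle).$$ -/

import Mathlib

open Filter Topology

noncomputable section

namespace LogResolvent

/-! ### Scalar weights -/

/-- The Japanese bracket `⟨x⟩ = √(1 + x²)`. -/
def bracket (x : ℝ) : ℝ := Real.sqrt (1 + x ^ 2)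

/-- Iterated logarithms: `log₀ x = 1`, `log₁ x = log (1 + x)` and
`log_{k+1} x = log (1 + log_k x)` for `k ≥ 1`. -/
def iterLog : ℕ → ℝ → ℝ
  | 0, _ => 1
  | 1, x => Real.log (1 + x)
  | k + 2, x => Real.log (1 + iterLog (k + 1) x)

/-! ### Unbounded operators, as partially defined linear maps -/

variable {H : Type*} [NormedAddCommGroup H] [InnerProductSpace ℂ H]

/-- The product `g f` of two unbounded operators, with its natural domain
`{ψ ∈ D(f) | f ψ ∈ D(g)}`. -/
def opMul (g f : H →ₗ.[ℂ] H) : H →ₗ.[ℂ] H where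
  domain := (g.domain.comap f.toFun).map f.domain.subtype
  toFun :=
    { toFun := fun ψ => g ⟨f ⟨ψ, by
          obtain ⟨x, _, hx⟩ := ψ.2
          exact hx ▸ x.2⟩, by
          obtain ⟨ψ, x, hx, rfl⟩ := ψ
          exact hx⟩
      map_add' := fun a b => by
        rw [← LinearPMap.map_add]
        congr 1
        apply Subtype.ext
        exact f.map_add ⟨a, _⟩ ⟨b, _⟩
      map_smul' := fun c a => by
        rw [RingHom.id_apply, ← LinearPMap.map_smul]
        congr 1
        apply Subtype.ext
        exact f.map_smul c ⟨a, _⟩ }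

/-- The operator `A - z`, with domain `D(A)`. -/
def shift (A : H →ₗ.[ℂ] H) (z : ℂ) : H →ₗ.[ℂ] H :=
  (-(z • LinearMap.id) : H →ₗ[ℂ] H) +ᵥ A

/-- The operator `(A - z)⁻¹`, with domain the range of `A - z`.
(It is meaningful when `A - z` is injective, as it is for `A` self-adjoint and `z` not real.) -/
def resolvent (A : H →ₗ.[ℂ] H) (z : ℂ) : H →ₗ.[ℂ] H := (shift A z).inverse

/-- `(A - z)⁻¹` as an everywhere defined bounded operator, for `z` in the resolvent set of `A`
(in particular for `A` self-adjoint and `z` not real); it is `0` for other `z`. -/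
def resolventCLM (A : H →ₗ.[ℂ] H) (z : ℂ) : H →L[ℂ] H :=
  open Classical in
  if h : ∃ R : H →L[ℂ] H, (R : H →ₗ[ℂ] H).toPMap ⊤ = resolvent A z then h.choose else 0

/-- `L` is densely defined and bounded with norm at most `K`; equivalently, it extends to a
(unique) bounded operator on `H`, of norm at most `K`, when `H` is complete. -/
def OpNormLE (L : H →ₗ.[ℂ] H) (K : ℝ) : Prop :=
  Dense (L.domain : Set H) ∧ ∀ ψ : L.domain, ‖L ψ‖ ≤ K * ‖(ψ : H)‖

/-! ### Functional calculus of a self-adjoint operator -/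

variable [CompleteSpace H]

/-- `φ(A)` for `A` self-adjoint and `φ` continuous with compact support.
The bounded operator `R = (A - i)⁻¹` is normal, its spectrum consists of the points
`w = (t - i)⁻¹` with `t` in the spectrum of `A` and possibly of `0` (the value at `t = ∞`), and
`t = Re (w⁻¹)`. So `φ(A)` is the image of `R`, under the continuous functional calculus of
bounded normal operators, by the continuous function `(t - i)⁻¹ ↦ φ t`, `0 ↦ 0`. -/
def compactCalculus (A : H →ₗ.[ℂ] H) (φ : ℝ → ℝ) : H →L[ℂ] H :=
  open Classical in
  cfc (fun w : ℂ => if w = 0 then 0 else ((φ (w⁻¹).re : ℝ) : ℂ)) (resolventCLM A Complex.I)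

/-- The continuous cutoff which is `1` for `|t| ≤ n`, `0` for `|t| ≥ n + 1` and affine in
between. -/
def cutoff (n : ℕ) (t : ℝ) : ℝ := max 0 (min 1 ((n : ℝ) + 1 - |t|))

/-- `f(A)` for `A` self-adjoint and `f : ℝ → ℝ` continuous, possibly unbounded:
`f(A) ψ = lim_n (χ_n f)(A) ψ` with `χ_n` the cutoffs above, the domain being the set of those `ψ`
for which the limit exists. In terms of the spectral measure `μ_ψ` of `A` at `ψ` this domain is
`{ψ | ∫ |f|² dμ_ψ < ∞}`, by monotone and dominated convergence. -/
def functionalCalculus (A : H →ₗ.[ℂ] H) (f : ℝ → ℝ) : H →ₗ.[ℂ] H where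
  domain :=
    { carrier := {ψ | ∃ η : H,
        Tendsto (fun n : ℕ => compactCalculus A (fun t => cutoff n t * f t) ψ) atTop (𝓝 η)}
      zero_mem' := ⟨0, by simp⟩
      add_mem' := by
        rintro a b ⟨η, hη⟩ ⟨θ, hθ⟩
        exact ⟨η + θ, by simpa using hη.add hθ⟩
      smul_mem' := by
        rintro c a ⟨η, hη⟩
        exact ⟨c • η, by simpa using hη.const_smul c⟩ }
  toFun :=
    { toFun := fun ψ => ψ.2.choose
      map_add' := fun a b => by
        refine tendsto_nhds_unique (a + b).2.choose_spec ?_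
        simpa using a.2.choose_spec.add b.2.choose_spec
      map_smul' := fun c a => by
        refine tendsto_nhds_unique (c • a).2.choose_spec ?_
        simpa using a.2.choose_spec.const_smul c }

/-- `⟨A⟩^s`. -/
def bracketPow (A : H →ₗ.[ℂ] H) (s : ℝ) : H →ₗ.[ℂ] H :=
  functionalCalculus A (fun t => bracket t ^ s)

/-- `log^p (1 + ⟨A⟩)`. -/
def logPow (A : H →ₗ.[ℂ] H) (p : ℝ) : H →ₗ.[ℂ] H :=
  functionalCalculus A (fun t => Real.log (1 + bracket t) ^ p)

/-- `log_k^p (⟨A⟩)`. -/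
def iterLogPow (A : H →ₗ.[ℂ] H) (k : ℕ) (p : ℝ) : H →ₗ.[ℂ] H :=
  functionalCalculus A (fun t => iterLog k (bracket t) ^ p)

/-- The operator product `∏_{k=0}^m log_k^q (⟨A⟩)`. -/
def iterLogProd (A : H →ₗ.[ℂ] H) (q : ℝ) : ℕ → (H →ₗ.[ℂ] H)
  | 0 => iterLogPow A 0 q
  | m + 1 => opMul (iterLogProd A q m) (iterLogPow A (m + 1) q)

end LogResolvent

end

noncomputable section

namespace LogResolvent

/-! ### The Japanese bracket -/

section Bracket

/-! Under the functional calculus both operators become multiplication by $(t-z)^{-1}\langle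
t\rangle^s\ell(\langle t\rangle)$, with $\ell$ a product of powers of iterated logarithms, so the
claim is a supremum bound in $t$.

Scalar side: $\ell(v)/\ell(u)$ is at most a constant times any small positive power of
$\max(u/v,v/u)$. As $0<s<1$ leaves room on both sides, $v^s\ell(v)\lesssim u^s\ell(u)(1+v/u)$
(`SlowlyVarying.rpow_mul_le`). On $\Omega$ one has $1+\langle t\rangle/\langle
x\rangle\lesssim|t-z|/|y|$, which gives `SlowlyVarying.norm_div_le`.

Operator side: $R=(A-i)^{-1}$ is normal, and its continuous calculus yields $g\mapsto g(A)$ for $g$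
vanishing at infinity. This map is multiplicative, bounded by the supremum of $|g|$, and sends
$(t-z)^{-1}$ to $(A-z)^{-1}$ (`vanishingCalculus_inv_sub`). Unbounded weights enter through
`Represents`: $f(A)h(A)=(hf)(A)$ and $h(A)f(A)\subseteq(hf)(A)$ for decaying $h$, a property stable
under operator products. The first relation gives (1), the second the bound in (2). Density in (2)
holds because the domain contains the range of $R$, which is $D(A)$. -/

theorem bracket_eq_norm (x : ℝ) : bracket x = ‖(⟨1, x⟩ : ℂ)‖ := by
  rw [bracket, Complex.norm_def, Complex.normSq_mk]
  congr 1
  ring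

theorem one_le_bracket (x : ℝ) : 1 ≤ bracket x :=
  Real.one_le_sqrt.2 (by nlinarith [sq_nonneg x])

theorem bracket_pos (x : ℝ) : 0 < bracket x := one_pos.trans_le (one_le_bracket x)

theorem abs_le_bracket (x : ℝ) : |x| ≤ bracket x :=
  Real.abs_le_sqrt (by linarith)

theorem continuous_bracket : Continuous bracket := by
  unfold bracket
  fun_prop

/-- Triangle inequality for $1+it=(1+ix)+i(t-x)$. -/
theorem bracket_le_add (t x : ℝ) : bracket t ≤ bracket x + |t - x| := by
  rw [bracket_eq_norm, bracket_eq_norm]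
  have h : (⟨1, t⟩ : ℂ) = ⟨1, x⟩ + ((t - x : ℝ) : ℂ) * Complex.I := by
    apply Complex.ext <;> simp
  rw [h]
  refine (norm_add_le _ _).trans_eq ?_
  rw [norm_mul, Complex.norm_real, Complex.norm_I, mul_one, Real.norm_eq_abs]

theorem abs_sub_re_le_norm (t : ℝ) (z : ℂ) : |t - z.re| ≤ ‖(t : ℂ) - z‖ := by
  simpa using Complex.abs_re_le_norm ((t : ℂ) - z)

theorem abs_im_le_norm_sub (t : ℝ) (z : ℂ) : |z.im| ≤ ‖(t : ℂ) - z‖ := by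
  simpa using Complex.abs_im_le_norm ((t : ℂ) - z)

theorem bracket_le_mul_norm_sub {z : ℂ} (hz : z.im ≠ 0) (t : ℝ) :
    bracket t ≤ (bracket z.re / |z.im| + 1) * ‖(t : ℂ) - z‖ := by
  have h1 := bracket_le_add t z.re
  have h2 := abs_sub_re_le_norm t z
  have h3 : bracket z.re ≤ bracket z.re / |z.im| * ‖(t : ℂ) - z‖ := by
    rw [div_mul_eq_mul_div, le_div_iff₀ (abs_pos.2 hz)]
    exact mul_le_mul_of_nonneg_left (abs_im_le_norm_sub t z) (bracket_pos _).le
  linarith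

theorem norm_sub_pos {z : ℂ} (hz : z.im ≠ 0) (t : ℝ) : 0 < ‖(t : ℂ) - z‖ :=
  (abs_pos.2 hz).trans_le (abs_im_le_norm_sub t z)

theorem tendsto_bracket : Tendsto bracket (cocompact ℝ) atTop :=
  tendsto_atTop_mono abs_le_bracket (tendsto_norm_cocompact_atTop (E := ℝ))

end Bracket

/-! ### Slowly varying weights -/

section SlowlyVarying

/-- Positive continuous functions on `[1, ∞)` whose ratios at two points are bounded by any
positive power of the ratio of the points. -/
structure SlowlyVarying (ℓ : ℝ → ℝ) : Prop where
  pos : ∀ u, 1 ≤ u → 0 < ℓ u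
  continuousOn : ContinuousOn ℓ (Set.Ici 1)
  le : ∀ ε : ℝ, 0 < ε → ∃ C, 0 < C ∧ ∀ u v, 1 ≤ u → 1 ≤ v → ℓ v ≤ C * ℓ u * max (v / u) (u / v) ^ ε

theorem one_le_max_div {u v : ℝ} (hu : 1 ≤ u) (hv : 1 ≤ v) : 1 ≤ max (v / u) (u / v) := by
  rcases le_total u v with h | h
  · exact le_max_of_le_left ((one_le_div (by linarith)).2 h)
  · exact le_max_of_le_right ((one_le_div (by linarith)).2 h)

variable {ℓ ℓ' : ℝ → ℝ}

theorem SlowlyVarying.mul (h : SlowlyVarying ℓ) (h' : SlowlyVarying ℓ') :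
    SlowlyVarying fun u => ℓ u * ℓ' u where
  pos u hu := mul_pos (h.pos u hu) (h'.pos u hu)
  continuousOn := h.continuousOn.mul h'.continuousOn
  le ε hε := by
    obtain ⟨C, hC, hle⟩ := h.le (ε / 2) (half_pos hε)
    obtain ⟨C', hC', hle'⟩ := h'.le (ε / 2) (half_pos hε)
    refine ⟨C * C', mul_pos hC hC', fun u v hu hv => ?_⟩
    have hM := one_pos.trans_le (one_le_max_div hu hv)
    refine (mul_le_mul (hle u v hu hv) (hle' u v hu hv) (h'.pos v hv).le ?_).trans_eq ?_
    · have := h.pos u hu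
      positivity
    · rw [← add_halves ε, Real.rpow_add hM, add_halves]
      ring

/-- The defining bound is symmetric under exchanging $u$ and $v$, which is what inversion does to
the ratio. -/
theorem SlowlyVarying.inv (h : SlowlyVarying ℓ) : SlowlyVarying fun u => (ℓ u)⁻¹ where
  pos u hu := inv_pos.2 (h.pos u hu)
  continuousOn := h.continuousOn.inv₀ fun u hu => (h.pos u hu).ne'
  le ε hε := by
    obtain ⟨C, hC, hle⟩ := h.le ε hε
    refine ⟨C, hC, fun u v hu hv => ?_⟩
    have h1 := hle v u hv hu
    have hu' := h.pos u hu
    have hv' := h.pos v hv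
    rw [max_comm] at h1
    rw [mul_right_comm, ← div_eq_mul_inv, le_div_iff₀ hu', inv_mul_le_iff₀ hv']
    linarith

theorem SlowlyVarying.rpow_of_nonneg (h : SlowlyVarying ℓ) {p : ℝ} (hp : 0 ≤ p) :
    SlowlyVarying fun u => ℓ u ^ p where
  pos u hu := Real.rpow_pos_of_pos (h.pos u hu) p
  continuousOn := h.continuousOn.rpow_const fun u hu => Or.inl (h.pos u hu).ne'
  le ε hε := by
    -- Dividing by $p+1$ rather than $p$ allows $p=0$; the final exponent $\varepsilon
    -- p/(p+1)\le\varepsilon$ suffices since the maximum is at least $1$.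
    obtain ⟨C, hC, hle⟩ := h.le (ε / (p + 1)) (by positivity)
    refine ⟨C ^ p, by positivity, fun u v hu hv => ?_⟩
    have hM := one_le_max_div hu hv
    have hu' := h.pos u hu
    refine (Real.rpow_le_rpow (h.pos v hv).le (hle u v hu hv) hp).trans ?_
    rw [Real.mul_rpow (by positivity) (by positivity), Real.mul_rpow hC.le hu'.le,
      ← Real.rpow_mul (by positivity)]
    gcongr
    rw [div_mul_eq_mul_div, div_le_iff₀ (by positivity)]
    nlinarith

theorem SlowlyVarying.rpow (h : SlowlyVarying ℓ) (p : ℝ) : SlowlyVarying fun u => ℓ u ^ p := by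
  rcases le_total 0 p with hp | hp
  · exact h.rpow_of_nonneg hp
  · have h1 := (h.rpow_of_nonneg (neg_nonneg.2 hp)).inv
    refine ⟨fun u hu => Real.rpow_pos_of_pos (h.pos u hu) p,
      h.continuousOn.rpow_const fun u hu => Or.inl (h.pos u hu).ne', fun ε hε => ?_⟩
    obtain ⟨C, hC, hle⟩ := h1.le ε hε
    refine ⟨C, hC, fun u v hu hv => ?_⟩
    simpa only [Real.rpow_neg (h.pos u hu).le, Real.rpow_neg (h.pos v hv).le, inv_inv]
      using hle u v hu hv

theorem slowlyVarying_one : SlowlyVarying fun _ => 1 where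
  pos _ _ := one_pos
  continuousOn := continuousOn_const
  le ε hε := ⟨1, one_pos, fun u v hu hv => by
    simpa using Real.one_le_rpow (one_le_max_div hu hv) hε.le⟩

theorem SlowlyVarying.prod {ι : Type*} (s : Finset ι) {f : ι → ℝ → ℝ}
    (h : ∀ i, SlowlyVarying (f i)) : SlowlyVarying fun u => ∏ i ∈ s, f i u := by
  induction s using Finset.cons_induction with
  | empty => simpa using slowlyVarying_one
  | cons a s ha ih => simpa only [Finset.prod_cons] using (h a).mul ih

theorem iterLog_pos (k : ℕ) {u : ℝ} (hu : 1 ≤ u) : 0 < iterLog k u := by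
  induction k using Nat.twoStepInduction with
  | zero => exact one_pos
  | one => exact Real.log_pos (by linarith)
  | more k _ ih => exact Real.log_pos (by linarith)

theorem iterLog_mono (k : ℕ) {u v : ℝ} (hu : 1 ≤ u) (huv : u ≤ v) : iterLog k u ≤ iterLog k v := by
  induction k using Nat.twoStepInduction with
  | zero => exact le_rfl
  | one => exact Real.log_le_log (by linarith) (by linarith)
  | more k _ ih => exact Real.log_le_log (by linarith [iterLog_pos (k + 1) hu]) (by linarith)

theorem continuousOn_iterLog (k : ℕ) : ContinuousOn (iterLog k) (Set.Ici 1) := by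
  induction k using Nat.twoStepInduction with
  | zero => exact continuousOn_const
  | one =>
    refine ContinuousOn.log (by fun_prop) fun u hu => ?_
    have : (1 : ℝ) ≤ u := hu
    positivity
  | more k _ ih =>
    exact ContinuousOn.log (continuousOn_const.add ih) fun u hu =>
      (add_pos one_pos (iterLog_pos (k + 1) hu)).ne'

/-- Bernoulli's inequality $(1+a)^{b/a}\ge 1+b$, after taking logarithms. -/
theorem log_one_add_div_le {a b : ℝ} (ha : 0 < a) (hab : a ≤ b) :
    Real.log (1 + b) / Real.log (1 + a) ≤ b / a := by
  rw [div_le_iff₀ (Real.log_pos (by linarith)), ← Real.log_rpow (by linarith)]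
  have hb : 0 < b := ha.trans_le hab
  refine Real.log_le_log (by linarith) ?_
  have := one_add_mul_self_le_rpow_one_add (s := a) (by linarith) ((one_le_div ha).2 hab)
  rwa [div_mul_cancel₀ _ ha.ne'] at this

/-- Each further logarithm can only shrink the ratio, so all levels reduce to $\log(1+u)$. -/
theorem iterLog_succ_div_le (k : ℕ) {u v : ℝ} (hu : 1 ≤ u) (huv : u ≤ v) :
    iterLog (k + 1) v / iterLog (k + 1) u ≤ Real.log (1 + v) / Real.log (1 + u) := by
  induction k with
  | zero => exact le_rfl
  | succ k ih =>
    exact (log_one_add_div_le (iterLog_pos (k + 1) hu) (iterLog_mono (k + 1) hu huv)).trans ih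

/-- From $1+v\le(1+u)(v/u)$ and $\log r\le r^\varepsilon/\varepsilon$; the lower bound
$\log(1+u)\ge\log 2$ makes the additive error multiplicative. -/
theorem log_one_add_div_le_rpow {ε : ℝ} (hε : 0 < ε) {u v : ℝ} (hu : 1 ≤ u) (huv : u ≤ v) :
    Real.log (1 + v) / Real.log (1 + u) ≤ (1 + (ε * Real.log 2)⁻¹) * (v / u) ^ ε := by
  have hu0 : 0 < u := by linarith
  have hr : 1 ≤ v / u := (one_le_div hu0).2 huv
  have hl2 : 0 < Real.log 2 := Real.log_pos one_lt_two
  have h1 : Real.log (1 + v) ≤ Real.log (1 + u) + Real.log (v / u) := by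
    rw [← Real.log_mul (by positivity) (by positivity)]
    refine Real.log_le_log (by linarith) ?_
    rw [add_mul, one_mul, mul_div_cancel₀ _ hu0.ne']
    linarith
  have h2 : Real.log (v / u) ≤ (v / u) ^ ε / ε := Real.log_le_rpow_div (by linarith) hε
  have h3 : Real.log 2 ≤ Real.log (1 + u) := Real.log_le_log two_pos (by linarith)
  have h4 : 1 ≤ (v / u) ^ ε := Real.one_le_rpow hr hε.le
  rw [div_le_iff₀ (by linarith)]
  have h5 : (v / u) ^ ε / ε ≤ (ε * Real.log 2)⁻¹ * (v / u) ^ ε * Real.log (1 + u) := by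
    have : (v / u) ^ ε / ε = (ε * Real.log 2)⁻¹ * (v / u) ^ ε * Real.log 2 := by
      field_simp
    rw [this]
    gcongr
  nlinarith

theorem slowlyVarying_iterLog (k : ℕ) : SlowlyVarying (iterLog k) := by
  refine ⟨fun u => iterLog_pos k, continuousOn_iterLog k, fun ε hε => ?_⟩
  cases k with
  | zero => exact slowlyVarying_one.le ε hε
  | succ k =>
    have hl2 : 0 < Real.log 2 := Real.log_pos one_lt_two
    refine ⟨1 + (ε * Real.log 2)⁻¹, by positivity, fun u v hu hv => ?_⟩
    have hu' := iterLog_pos (k + 1) hu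
    have hM := one_le_max_div hu hv
    rw [mul_right_comm, ← div_le_iff₀ hu']
    rcases le_total u v with h | h
    · refine ((iterLog_succ_div_le k hu h).trans (log_one_add_div_le_rpow hε hu h)).trans ?_
      gcongr
      exact le_max_left _ _
    · have h1 : iterLog (k + 1) v / iterLog (k + 1) u ≤ 1 :=
        (div_le_one hu').2 (iterLog_mono (k + 1) hv h)
      refine h1.trans (one_le_mul_of_one_le_of_one_le ?_ (Real.one_le_rpow hM hε.le))
      exact le_add_of_nonneg_right (by positivity)

/-- For $v\le u$ a loss of $(u/v)^s$ from $\ell$ is absorbed by $(v/u)^s$, leaving a constant. For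
$v\ge u$ a loss of $(v/u)^{1-s}$ raises $(v/u)^s$ to $v/u$. Both exponents must be positive, hence
$0<s<1$. -/
theorem SlowlyVarying.rpow_mul_le (h : SlowlyVarying ℓ) {s : ℝ} (hs0 : 0 < s) (hs1 : s < 1) :
    ∃ C, 0 < C ∧ ∀ u v, 1 ≤ u → 1 ≤ v → v ^ s * ℓ v ≤ C * (u ^ s * ℓ u) * (1 + v / u) := by
  obtain ⟨C₁, hC₁, h₁⟩ := h.le s hs0
  obtain ⟨C₂, hC₂, h₂⟩ := h.le (1 - s) (sub_pos.2 hs1)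
  refine ⟨C₁ + C₂, by positivity, fun u v hu hv => ?_⟩
  have hu' := h.pos u hu
  have hu0 : 0 < u := by linarith
  have hv0 : 0 < v := by linarith
  have hvs : v ^ s = u ^ s * (v / u) ^ s := by
    rw [← Real.mul_rpow hu0.le (by positivity), mul_div_cancel₀ _ hu0.ne']
  have hP : 0 < u ^ s * ℓ u := by positivity
  have hvu : 0 < v / u := by positivity
  rcases le_total v u with hle | hle
  · have h3 := h₁ u v hu hv
    have hm : max (v / u) (u / v) = (v / u)⁻¹ := by
      rw [inv_div, max_eq_right]
      exact ((div_le_one hu0).2 hle).trans ((one_le_div hv0).2 hle)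
    rw [hm, Real.inv_rpow hvu.le] at h3
    calc v ^ s * ℓ v ≤ u ^ s * (v / u) ^ s * (C₁ * ℓ u * ((v / u) ^ s)⁻¹) := by
          rw [hvs]; gcongr
      _ = C₁ * (u ^ s * ℓ u) := by field_simp
      _ ≤ (C₁ + C₂) * (u ^ s * ℓ u) * (1 + v / u) := by
          nlinarith [mul_pos hC₂ hP, mul_pos (mul_pos (add_pos hC₁ hC₂) hP) hvu]
  · have h3 := h₂ u v hu hv
    have hm : max (v / u) (u / v) = v / u := by
      rw [max_eq_left]
      exact ((div_le_one hv0).2 hle).trans ((one_le_div hu0).2 hle)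
    rw [hm] at h3
    calc v ^ s * ℓ v ≤ u ^ s * (v / u) ^ s * (C₂ * ℓ u * (v / u) ^ (1 - s)) := by
          rw [hvs]; gcongr
      _ = C₂ * (u ^ s * ℓ u) * ((v / u) ^ s * (v / u) ^ (1 - s)) := by ring
      _ = C₂ * (u ^ s * ℓ u) * (v / u) := by
          rw [← Real.rpow_add hvu, add_sub_cancel, Real.rpow_one]
      _ ≤ (C₁ + C₂) * (u ^ s * ℓ u) * (1 + v / u) := by
          nlinarith [mul_pos hC₁ hP, mul_pos (mul_pos hC₁ hP) hvu, mul_pos hC₂ hP]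

end SlowlyVarying

/-! ### Growth and decay on the line -/

section Growth

/-- Continuous functions which grow more slowly than any positive power. -/
structure SlowlyGrowing (f : ℝ → ℝ) : Prop where
  continuous : Continuous f
  le : ∀ ε : ℝ, 0 < ε → ∃ C, ∀ t, |f t| ≤ C * bracket t ^ ε

/-- Continuous functions which decay like a negative power. -/
structure Decaying (h : ℝ → ℂ) : Prop where
  continuous : Continuous h
  le : ∃ δ : ℝ, 0 < δ ∧ ∃ C, ∀ t, ‖h t‖ ≤ C * bracket t ^ (-δ)

theorem SlowlyVarying.slowlyGrowing {ℓ : ℝ → ℝ} (h : SlowlyVarying ℓ) :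
    SlowlyGrowing fun t => ℓ (bracket t) where
  continuous := h.continuousOn.comp_continuous continuous_bracket one_le_bracket
  le ε hε := by
    obtain ⟨C, -, hle⟩ := h.le ε hε
    refine ⟨C * ℓ 1, fun t => ?_⟩
    have h1 := one_le_bracket t
    have h2 := hle 1 (bracket t) le_rfl h1
    rw [abs_of_pos (h.pos _ h1)]
    rwa [div_one, max_eq_left (((div_le_one (bracket_pos t)).2 h1).trans h1)] at h2

theorem SlowlyGrowing.mul {f g : ℝ → ℝ} (hf : SlowlyGrowing f) (hg : SlowlyGrowing g) :
    SlowlyGrowing fun t => f t * g t where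
  continuous := hf.continuous.mul hg.continuous
  le ε hε := by
    obtain ⟨C, hC⟩ := hf.le (ε / 2) (half_pos hε)
    obtain ⟨C', hC'⟩ := hg.le (ε / 2) (half_pos hε)
    refine ⟨C * C', fun t => ?_⟩
    rw [abs_mul]
    refine (mul_le_mul (hC t) (hC' t) (abs_nonneg _) ((abs_nonneg _).trans (hC t))).trans_eq ?_
    rw [← add_halves ε, Real.rpow_add (bracket_pos t), add_halves]
    ring

/-- Half of the decay exponent pays for the growth of `f`. This closure lets weights be absorbed one
at a time. -/
theorem Decaying.mul {h : ℝ → ℂ} {f : ℝ → ℝ} (hh : Decaying h) (hf : SlowlyGrowing f) :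
    Decaying fun t => h t * f t where
  continuous := hh.continuous.mul (Complex.continuous_ofReal.comp hf.continuous)
  le := by
    obtain ⟨δ, hδ, C, hC⟩ := hh.le
    obtain ⟨C', hC'⟩ := hf.le (δ / 2) (half_pos hδ)
    refine ⟨δ / 2, half_pos hδ, C * C', fun t => ?_⟩
    rw [norm_mul, Complex.norm_real, Real.norm_eq_abs]
    refine (mul_le_mul (hC t) (hC' t) (abs_nonneg _) ((norm_nonneg _).trans (hC t))).trans_eq ?_
    rw [show -(δ / 2) = -δ + δ / 2 by ring, Real.rpow_add (bracket_pos t)]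
    ring

theorem Decaying.tendsto {h : ℝ → ℂ} (hh : Decaying h) : Tendsto h (cocompact ℝ) (𝓝 0) := by
  obtain ⟨δ, hδ, C, hC⟩ := hh.le
  refine squeeze_zero_norm hC ?_
  simpa using ((tendsto_rpow_neg_atTop hδ).comp tendsto_bracket).const_mul C

/-- For fixed $z$ the quotient $\langle t\rangle/|t-z|$ is bounded, which leaves $\langle
t\rangle^{s-1}$. The constant here need not be uniform in $z$. -/
theorem decaying_bracket_rpow_div {s : ℝ} (hs : s < 1) {z : ℂ} (hz : z.im ≠ 0) :
    Decaying fun t => ((t : ℂ) - z)⁻¹ * ((bracket t ^ s : ℝ) : ℂ) where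
  continuous := by
    refine Continuous.mul (Continuous.inv₀ (by fun_prop) fun t => norm_pos_iff.1 ?_) ?_
    · exact norm_sub_pos hz t
    · exact Complex.continuous_ofReal.comp
        (continuous_bracket.rpow_const fun t => Or.inl (bracket_pos t).ne')
  le := by
    refine ⟨1 - s, sub_pos.2 hs, bracket z.re / |z.im| + 1, fun t => ?_⟩
    have hb := bracket_pos t
    rw [norm_mul, norm_inv, Complex.norm_real, Real.norm_of_nonneg (by positivity), neg_sub,
      Real.rpow_sub hb, Real.rpow_one, inv_mul_le_iff₀ (norm_sub_pos hz t)]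
    have := bracket_le_mul_norm_sub hz t
    calc bracket t ^ s = bracket t * (bracket t ^ s / bracket t) := by field_simp
      _ ≤ (bracket z.re / |z.im| + 1) * ‖(t : ℂ) - z‖ * (bracket t ^ s / bracket t) := by gcongr
      _ = _ := by ring

theorem decaying_inv_sub {z : ℂ} (hz : z.im ≠ 0) : Decaying fun t : ℝ => ((t : ℂ) - z)⁻¹ := by
  simpa using decaying_bracket_rpow_div zero_lt_one hz

theorem SlowlyVarying.norm_div_le {ℓ : ℝ → ℝ} (h : SlowlyVarying ℓ) {s c : ℝ} (hs0 : 0 < s)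
    (hs1 : s < 1) (hc : 0 < c) : ∃ C, 0 < C ∧ ∀ z : ℂ, 0 < |z.im| → |z.im| ≤ c * bracket z.re →
      ∀ t : ℝ, ‖((t : ℂ) - z)⁻¹ * ((bracket t ^ s : ℝ) : ℂ) * (ℓ (bracket t) : ℂ)‖ ≤
        C * (bracket z.re ^ s * ℓ (bracket z.re)) * |z.im|⁻¹ := by
  obtain ⟨C, hC, hle⟩ := h.rpow_mul_le hs0 hs1
  refine ⟨C * (2 + c), by positivity, fun z hz hzc t => ?_⟩
  have ht := one_le_bracket t
  have hx := one_le_bracket z.re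
  have hx0 := bracket_pos z.re
  have hN := norm_sub_pos (abs_pos.1 hz) t
  have h1 : 0 < bracket z.re ^ s * ℓ (bracket z.re) :=
    mul_pos (Real.rpow_pos_of_pos hx0 s) (h.pos _ hx)
  have h2 : 0 < bracket t ^ s * ℓ (bracket t) :=
    mul_pos (Real.rpow_pos_of_pos (bracket_pos t) s) (h.pos _ ht)
  rw [mul_assoc, ← Complex.ofReal_mul, norm_mul, norm_inv, Complex.norm_real,
    Real.norm_of_nonneg h2.le, inv_mul_le_iff₀ hN]
  -- With $X=|t-z|/|y|\ge1$, the condition $|y|\le c\langle x\rangle$ gives $|t-x|\le|t-z|\le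
  -- cX\langle x\rangle$, so the left side is at most $2+cX\le(2+c)X$.
  have h3 : 1 + bracket t / bracket z.re ≤ (2 + c) * (‖(t : ℂ) - z‖ * |z.im|⁻¹) := by
    have h4 : 1 ≤ ‖(t : ℂ) - z‖ * |z.im|⁻¹ := by
      rw [← div_eq_mul_inv, one_le_div hz]
      exact abs_im_le_norm_sub t z
    have h5 : bracket t / bracket z.re ≤ 1 + c * (‖(t : ℂ) - z‖ * |z.im|⁻¹) := by
      rw [div_le_iff₀ hx0]
      have h6 := bracket_le_add t z.re
      have h7 := abs_sub_re_le_norm t z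
      have h8 : ‖(t : ℂ) - z‖ ≤ c * (‖(t : ℂ) - z‖ * |z.im|⁻¹) * bracket z.re := by
        calc ‖(t : ℂ) - z‖ = ‖(t : ℂ) - z‖ * |z.im|⁻¹ * |z.im| := by field_simp
          _ ≤ ‖(t : ℂ) - z‖ * |z.im|⁻¹ * (c * bracket z.re) := by gcongr
          _ = _ := by ring
      linarith
    linarith
  calc bracket t ^ s * ℓ (bracket t)
      ≤ C * (bracket z.re ^ s * ℓ (bracket z.re)) * (1 + bracket t / bracket z.re) :=
        hle _ _ hx ht
    _ ≤ C * (bracket z.re ^ s * ℓ (bracket z.re)) *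
        ((2 + c) * (‖(t : ℂ) - z‖ * |z.im|⁻¹)) := by gcongr
    _ = _ := by ring

end Growth

/-! ### Graphs of unbounded operators -/

section Graph

variable {H : Type*} [NormedAddCommGroup H] [InnerProductSpace ℂ H]

/-- Products become composition of relations, so the nested natural domains need not be handled
directly. -/
theorem mem_graph_opMul {g f : H →ₗ.[ℂ] H} {ψ η : H} :
    (ψ, η) ∈ (opMul g f).graph ↔ ∃ θ, (ψ, θ) ∈ f.graph ∧ (θ, η) ∈ g.graph := by
  simp only [LinearPMap.mem_graph_iff]
  constructor
  · rintro ⟨⟨_, x, hx, rfl⟩, rfl, h⟩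
    exact ⟨f x, ⟨x, rfl, rfl⟩, ⟨f x, hx⟩, rfl, h⟩
  · rintro ⟨_, ⟨x, rfl, rfl⟩, ⟨y, hy, rfl⟩⟩
    obtain ⟨y, hy'⟩ := y
    obtain rfl : y = f x := hy
    exact ⟨⟨x, x, hy', rfl⟩, rfl, rfl⟩

theorem opNormLE_of_graph {L : H →ₗ.[ℂ] H} {K : ℝ} {D : Set H} (hD : Dense D)
    (hdom : ∀ ψ ∈ D, ∃ η, (ψ, η) ∈ L.graph)
    (hle : ∀ ψ η, (ψ, η) ∈ L.graph → ‖η‖ ≤ K * ‖ψ‖) : OpNormLE L K :=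
  ⟨hD.mono fun ψ hψ => LinearPMap.mem_domain_iff.2 (hdom ψ hψ), fun ψ => hle _ _ (L.mem_graph ψ)⟩

theorem mem_graph_shift {A : H →ₗ.[ℂ] H} {z : ℂ} {ψ η : H} :
    (ψ, η) ∈ (shift A z).graph ↔ (ψ, η + z • ψ) ∈ A.graph := by
  simp only [LinearPMap.mem_graph_iff, shift]
  constructor
  · rintro ⟨x, rfl, rfl⟩
    refine ⟨x, rfl, ?_⟩
    simp only [LinearPMap.vadd_apply]
    simp
  · rintro ⟨x, rfl, h⟩
    refine ⟨x, rfl, ?_⟩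
    simp only [LinearPMap.vadd_apply]
    simp [h]

end Graph

/-! ### Resolvents of self-adjoint operators -/

section Resolvent

variable {H : Type*} [NormedAddCommGroup H] [InnerProductSpace ℂ H] [CompleteSpace H]
  {A : H →ₗ.[ℂ] H}

local notation "⟪" x ", " y "⟫" => inner ℂ x y

theorem inner_eq_of_mem_graph (hA : IsSelfAdjoint A) {ψ η φ θ : H}
    (h : (ψ, η) ∈ A.graph) (h' : (φ, θ) ∈ A.graph) : ⟪η, φ⟫ = ⟪ψ, θ⟫ := by
  have key := LinearPMap.adjoint_isFormalAdjoint hA.dense_domain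
  rw [LinearPMap.isSelfAdjoint_def.1 hA] at key
  obtain ⟨x, rfl, rfl⟩ := (LinearPMap.mem_graph_iff _).1 h
  obtain ⟨y, rfl, rfl⟩ := (LinearPMap.mem_graph_iff _).1 h'
  exact key x y

theorem mem_graph_of_inner_eq (hA : IsSelfAdjoint A) {φ θ : H}
    (h : ∀ ψ η, (ψ, η) ∈ A.graph → ⟪θ, ψ⟫ = ⟪φ, η⟫) : (φ, θ) ∈ A.graph := by
  have hx : ∀ x : A.domain, ⟪θ, (x : H)⟫ = ⟪φ, A x⟫ := fun x => h _ _ (A.mem_graph x)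
  have hφ := A.mem_adjoint_domain_of_exists φ ⟨θ, hx⟩
  have := LinearPMap.adjoint_apply_eq hA.dense_domain ⟨φ, hφ⟩ hx
  have hg : (φ, θ) ∈ A.adjoint.graph := (LinearPMap.mem_graph_iff _).2 ⟨⟨φ, hφ⟩, rfl, this⟩
  rwa [LinearPMap.isSelfAdjoint_def.1 hA] at hg

/-- Symmetry gives $\mathrm{Im}\langle\psi,(A-z)\psi\rangle=-\mathrm{Im}(z)\,\|\psi\|^2$; then
Cauchy–Schwarz. This yields injectivity, closed range and the resolvent bound. -/
theorem abs_im_mul_norm_le (hA : IsSelfAdjoint A) {z : ℂ} {ψ η : H}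
    (h : (ψ, η) ∈ (shift A z).graph) : |z.im| * ‖ψ‖ ≤ ‖η‖ := by
  rw [mem_graph_shift] at h
  have hs := inner_eq_of_mem_graph hA h h
  have him : (⟪ψ, η⟫).im = - z.im * ‖ψ‖ ^ 2 := by
    have h1 : (⟪ψ, η + z • ψ⟫).im = 0 := by
      rw [← Complex.conj_eq_iff_im, inner_conj_symm]
      exact hs
    rw [inner_add_right, inner_smul_right, inner_self_eq_norm_sq_to_K] at h1
    have h2 : (z * (↑‖ψ‖ : ℂ) ^ 2).im = z.im * ‖ψ‖ ^ 2 := by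
      rw [← Complex.ofReal_pow, Complex.im_mul_ofReal]
    rw [Complex.add_im] at h1
    have h3 : (z * ((‖ψ‖ : ℝ) : ℂ) ^ 2).im = z.im * ‖ψ‖ ^ 2 := h2
    erw [h3] at h1
    linarith
  have h1 : |z.im| * ‖ψ‖ ^ 2 ≤ ‖ψ‖ * ‖η‖ := by
    calc |z.im| * ‖ψ‖ ^ 2 = |(⟪ψ, η⟫).im| := by
          rw [him, abs_mul, abs_neg, abs_of_nonneg (sq_nonneg ‖ψ‖)]
      _ ≤ ‖⟪ψ, η⟫‖ := Complex.abs_im_le_norm _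
      _ ≤ _ := norm_inner_le_norm _ _
  rcases (norm_nonneg ψ).eq_or_lt' with h0 | h0
  · rw [h0, mul_zero]; exact norm_nonneg _
  · nlinarith

theorem eq_of_mem_graph_shift (hA : IsSelfAdjoint A) {z : ℂ} (hz : z.im ≠ 0) {ψ φ η : H}
    (h : (ψ, η) ∈ (shift A z).graph) (h' : (φ, η) ∈ (shift A z).graph) : ψ = φ := by
  have := abs_im_mul_norm_le hA ((shift A z).graph.sub_mem h h')
  simp only [sub_self, norm_zero] at this
  have h0 : ‖ψ - φ‖ ≤ 0 := by
    have := abs_pos.2 hz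
    by_contra! hc
    nlinarith [mul_pos this hc]
  exact sub_eq_zero.1 (norm_le_zero_iff.1 h0)

/-- The range is closed, by the lower bound and closedness of $A$, and its orthogonal complement is
trivial. -/
theorem exists_mem_graph_shift (hA : IsSelfAdjoint A) {z : ℂ} (hz : z.im ≠ 0) (η : H) :
    ∃ ψ, (ψ, η) ∈ (shift A z).graph := by
  set M : Submodule ℂ H := (shift A z).graph.map (LinearMap.snd ℂ H H) with hM
  have hmem : ∀ η, η ∈ M ↔ ∃ ψ, (ψ, η) ∈ (shift A z).graph := by
    intro η
    simp [hM]
  have hclosed : IsClosed (M : Set H) := by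
    refine isClosed_of_closure_subset fun η hη => ?_
    obtain ⟨u, hu, hlim⟩ := mem_closure_iff_seq_limit.1 hη
    choose v hv using fun n => (hmem (u n)).1 (hu n)
    have hcau : CauchySeq v := by
      rw [Metric.cauchySeq_iff]
      intro ε hε
      obtain ⟨N, hN⟩ := Metric.cauchySeq_iff.1 hlim.cauchySeq (|z.im| * ε)
        (mul_pos (abs_pos.2 hz) hε)
      refine ⟨N, fun m hm n hn => ?_⟩
      have h1 := abs_im_mul_norm_le hA ((shift A z).graph.sub_mem (hv m) (hv n))
      have h2 := hN m hm n hn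
      rw [dist_eq_norm] at h2 ⊢
      exact lt_of_mul_lt_mul_left (h1.trans_lt h2) (abs_nonneg _)
    obtain ⟨ψ, hψ⟩ := cauchySeq_tendsto_of_complete hcau
    refine (hmem η).2 ⟨ψ, mem_graph_shift.2 ?_⟩
    have hAc : IsClosed (A.graph : Set (H × H)) := hA.isClosed
    exact hAc.mem_of_tendsto (hψ.prodMk_nhds (hlim.add (hψ.const_smul z)))
      (Eventually.of_forall fun n => mem_graph_shift.1 (hv n))
  have htop : M = ⊤ := by
    have : CompleteSpace M := hclosed.completeSpace_coe
    rw [← Submodule.orthogonal_eq_bot_iff, Submodule.eq_bot_iff]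
    intro φ hφ
    -- Orthogonality to the range of $A-z$ says $A^*\varphi=\bar z\varphi$, and $A^*=A$; but $A-\bar
    -- z$ is injective.
    have h1 : (φ, (starRingEnd ℂ z) • φ) ∈ A.graph := by
      refine mem_graph_of_inner_eq hA fun ψ η hη => ?_
      have : η - z • ψ ∈ M := (hmem _).2 ⟨ψ, mem_graph_shift.2 (by simpa using hη)⟩
      have h2 := (Submodule.mem_orthogonal' M φ).1 hφ _ this
      rw [inner_sub_right, inner_smul_right, sub_eq_zero] at h2
      rw [h2, inner_smul_left, Complex.conj_conj]
    have h2 : (φ, 0) ∈ (shift A (starRingEnd ℂ z)).graph := mem_graph_shift.2 (by simpa using h1)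
    exact eq_of_mem_graph_shift hA (by simpa using hz) h2 (Submodule.zero_mem _)
  exact (hmem η).1 (htop ▸ Submodule.mem_top)

theorem mem_graph_resolvent (hA : IsSelfAdjoint A) {z : ℂ} (hz : z.im ≠ 0) {ψ η : H} :
    (ψ, η) ∈ (resolvent A z).graph ↔ (η, ψ) ∈ (shift A z).graph := by
  rw [resolvent, LinearPMap.inverse_graph]
  · simp
  · rw [LinearMap.ker_eq_bot']
    intro x hx
    have h := (shift A z).mem_graph x
    rw [← LinearPMap.toFun_eq_coe, hx] at h
    exact Subtype.ext (eq_of_mem_graph_shift hA hz h (Submodule.zero_mem _))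

theorem exists_resolvent_eq_toPMap (hA : IsSelfAdjoint A) {z : ℂ} (hz : z.im ≠ 0) :
    ∃ R : H →L[ℂ] H, (R : H →ₗ[ℂ] H).toPMap ⊤ = resolvent A z := by
  choose f hf using exists_mem_graph_shift hA hz
  let R₀ : H →ₗ[ℂ] H :=
    { toFun := f
      map_add' := fun a b => eq_of_mem_graph_shift hA hz (hf _)
        ((shift A z).graph.add_mem (hf a) (hf b))
      map_smul' := fun c a => eq_of_mem_graph_shift hA hz (hf _)
        ((shift A z).graph.smul_mem c (hf a)) }
  refine ⟨R₀.mkContinuous |z.im|⁻¹ fun η => ?_, LinearPMap.eq_of_eq_graph ?_⟩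
  · rw [inv_mul_eq_div, le_div_iff₀' (abs_pos.2 hz)]
    exact abs_im_mul_norm_le hA (hf η)
  · ext ⟨ψ, η⟩
    rw [mem_graph_resolvent hA hz, LinearPMap.mem_graph_iff]
    constructor
    · rintro ⟨x, rfl, rfl⟩
      exact hf x
    · intro h
      exact ⟨⟨ψ, trivial⟩, rfl, eq_of_mem_graph_shift hA hz (hf ψ) h⟩

theorem toPMap_resolventCLM (hA : IsSelfAdjoint A) {z : ℂ} (hz : z.im ≠ 0) :
    (resolventCLM A z : H →ₗ[ℂ] H).toPMap ⊤ = resolvent A z := by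
  have h := exists_resolvent_eq_toPMap hA hz
  rw [resolventCLM, dif_pos h]
  exact h.choose_spec

theorem mem_graph_resolvent_iff (hA : IsSelfAdjoint A) {z : ℂ} (hz : z.im ≠ 0) {ψ η : H} :
    (ψ, η) ∈ (resolvent A z).graph ↔ η = resolventCLM A z ψ := by
  rw [← toPMap_resolventCLM hA hz, LinearPMap.mem_graph_iff]
  constructor
  · rintro ⟨x, rfl, rfl⟩
    rfl
  · rintro rfl
    exact ⟨⟨ψ, trivial⟩, rfl, rfl⟩

theorem eq_resolventCLM_iff (hA : IsSelfAdjoint A) {z : ℂ} (hz : z.im ≠ 0) {ψ η : H} :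
    η = resolventCLM A z ψ ↔ (η, ψ + z • η) ∈ A.graph := by
  rw [← mem_graph_resolvent_iff hA hz, mem_graph_resolvent hA hz, mem_graph_shift]

theorem resolventCLM_mem_graph (hA : IsSelfAdjoint A) {z : ℂ} (hz : z.im ≠ 0) (ψ : H) :
    (resolventCLM A z ψ, ψ + z • resolventCLM A z ψ) ∈ A.graph :=
  (eq_resolventCLM_iff hA hz).1 rfl

theorem dense_range_resolventCLM (hA : IsSelfAdjoint A) {z : ℂ} (hz : z.im ≠ 0) :
    DenseRange (resolventCLM A z) := by
  refine hA.dense_domain.mono fun ψ hψ => ?_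
  refine ⟨A ⟨ψ, hψ⟩ - z • ψ, ((eq_resolventCLM_iff hA hz).2 ?_).symm⟩
  rw [sub_add_cancel]
  exact A.mem_graph ⟨ψ, hψ⟩

/-- The first resolvent identity. -/
theorem resolventCLM_sub (hA : IsSelfAdjoint A) {z w : ℂ} (hz : z.im ≠ 0) (hw : w.im ≠ 0) :
    resolventCLM A z - resolventCLM A w = (z - w) • (resolventCLM A z * resolventCLM A w) := by
  ext ψ
  have h : resolventCLM A w ψ = resolventCLM A z (ψ + (w - z) • resolventCLM A w ψ) := by
    rw [eq_resolventCLM_iff hA hz]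
    convert resolventCLM_mem_graph hA hw ψ using 2
    module
  rw [map_add, map_smul] at h
  simp only [sub_apply, smul_apply,
    mul_apply_eq_comp]
  nth_rewrite 1 [h]
  module

theorem star_resolventCLM (hA : IsSelfAdjoint A) {z : ℂ} (hz : z.im ≠ 0) :
    star (resolventCLM A z) = resolventCLM A (starRingEnd ℂ z) := by
  have hz' : (starRingEnd ℂ z).im ≠ 0 := by simpa using hz
  rw [ContinuousLinearMap.star_eq_adjoint, eq_comm, ContinuousLinearMap.eq_adjoint_iff]
  intro ψ η
  have h := inner_eq_of_mem_graph hA (resolventCLM_mem_graph hA hz' ψ)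
    (resolventCLM_mem_graph hA hz η)
  rw [inner_add_left, inner_add_right, inner_smul_left, inner_smul_right, Complex.conj_conj] at h
  exact (add_right_cancel h).symm

/-- Exchanging $z$ and $\bar z$ in the resolvent identity reverses the product; the factor $z-\bar
z\ne0$ cancels. -/
theorem isStarNormal_resolventCLM (hA : IsSelfAdjoint A) {z : ℂ} (hz : z.im ≠ 0) :
    IsStarNormal (resolventCLM A z) := by
  have hz' : (starRingEnd ℂ z).im ≠ 0 := by simpa using hz
  refine ⟨?_⟩
  rw [star_resolventCLM hA hz, Commute, SemiconjBy]
  have h1 := resolventCLM_sub hA hz hz'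
  have h2 := resolventCLM_sub hA hz' hz
  rw [← neg_sub, h1, ← neg_smul, neg_sub] at h2
  refine (smul_right_injective _ ?_ h2).symm
  intro h
  apply hz
  have := congrArg Complex.im h
  simp at this
  linarith

end Resolvent

/-! ### The functional calculus for continuous functions vanishing at infinity -/

section VanishingCalculus

/-- Continuous functions on the line which vanish at infinity. -/
structure VanishesAtInfinity (g : ℝ → ℂ) : Prop where
  continuous : Continuous g
  tendsto : Tendsto g (cocompact ℝ) (𝓝 0)

theorem Decaying.vanishesAtInfinity {h : ℝ → ℂ} (hh : Decaying h) : VanishesAtInfinity h :=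
  ⟨hh.continuous, hh.tendsto⟩

theorem VanishesAtInfinity.exists_norm_le {g : ℝ → ℂ} (hg : VanishesAtInfinity g) {ε : ℝ}
    (hε : 0 < ε) : ∃ N : ℝ, ∀ t, N < |t| → ‖g t‖ < ε := by
  have h := hg.tendsto.eventually (Metric.ball_mem_nhds (0 : ℂ) hε)
  rw [← Metric.cobounded_eq_cocompact,
    (Metric.hasBasis_cobounded_compl_closedBall (0 : ℝ)).eventually_iff] at h
  obtain ⟨N, -, hN⟩ := h
  refine ⟨N, fun t ht => ?_⟩
  have := hN (x := t) (by simpa using ht)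
  simpa using this

/-- The points `(t - i)⁻¹` for real `t`, and `0`. -/
def resolventCircle : Set ℂ := {w | w ≠ 0 → w⁻¹.im = -1}

/-- The function `(t - i)⁻¹ ↦ g t`, `0 ↦ 0`. -/
def pullback (g : ℝ → ℂ) (w : ℂ) : ℂ := open Classical in if w = 0 then 0 else g (w⁻¹).re

theorem pullback_zero (g : ℝ → ℂ) : pullback g 0 = 0 := if_pos rfl

theorem pullback_of_ne {w : ℂ} (hw : w ≠ 0) (g : ℝ → ℂ) : pullback g w = g (w⁻¹).re := if_neg hw

/-- Away from $0$ this is a composition. Near $0$, $|w^{-1}|$ is large while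
$\mathrm{Im}\,w^{-1}=-1$, so $|\mathrm{Re}\,w^{-1}|$ is large and `g` is small there. -/
theorem continuousOn_pullback {g : ℝ → ℂ} (hg : VanishesAtInfinity g) :
    ContinuousOn (pullback g) resolventCircle := by
  intro w hw
  by_cases h0 : w = 0
  · subst h0
    rw [Metric.continuousWithinAt_iff]
    intro ε hε
    obtain ⟨N, hN⟩ := hg.exists_norm_le hε
    refine ⟨(|N| + 1)⁻¹, by positivity, fun w hw hd => ?_⟩
    rw [pullback_zero, dist_zero_right]
    by_cases h0 : w = 0
    · simpa [h0, pullback_zero] using hε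
    rw [pullback_of_ne h0]
    apply hN
    rw [dist_zero_right] at hd
    have h1 : |N| + 1 < ‖w⁻¹‖ := by
      rw [norm_inv]
      exact (lt_inv_comm₀ (norm_pos_iff.2 h0) (by positivity)).1 hd
    have h2 := Complex.norm_le_abs_re_add_abs_im w⁻¹
    rw [hw h0, abs_neg, abs_one] at h2
    linarith [le_abs_self N]
  · apply ContinuousAt.continuousWithinAt
    have h1 : ContinuousAt (fun w : ℂ => g (w⁻¹).re) w :=
      hg.continuous.continuousAt.comp
        (Complex.continuous_re.continuousAt.comp (continuousAt_inv₀ h0))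
    refine h1.congr ?_
    filter_upwards [isOpen_ne.mem_nhds h0] with v hv
    exact (pullback_of_ne hv g).symm

variable {H : Type*} [NormedAddCommGroup H] [InnerProductSpace ℂ H] [CompleteSpace H]
  {A : H →ₗ.[ℂ] H}

/-- `g(A)` for `g` vanishing at infinity. -/
def vanishingCalculus (A : H →ₗ.[ℂ] H) (g : ℝ → ℂ) : H →L[ℂ] H :=
  cfc (pullback g) (resolventCLM A Complex.I)

theorem compactCalculus_eq (A : H →ₗ.[ℂ] H) (φ : ℝ → ℝ) :
    compactCalculus A φ = vanishingCalculus A fun t => (φ t : ℂ) := rfl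

/-- The resolvent identity at $\pm i$ reads $R-R^*=2iRR^*$. Functions with equal calculus agree on
the spectrum, so $\mathrm{Im}\,w=|w|^2$ there. -/
theorem spectrum_resolventCLM_subset (hA : IsSelfAdjoint A) :
    spectrum ℂ (resolventCLM A Complex.I) ⊆ resolventCircle := by
  have hI : Complex.I.im ≠ 0 := by simp
  have hn := isStarNormal_resolventCLM hA hI
  have h := resolventCLM_sub hA hI (w := starRingEnd ℂ Complex.I) (by simp)
  rw [← star_resolventCLM hA hI] at h
  set R := resolventCLM A Complex.I
  have h1 : cfc (fun w : ℂ => w - star w) R = R - star R := by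
    rw [cfc_sub .., cfc_id' ℂ R, cfc_star_id (R := ℂ) (a := R)]
  have h2 : cfc (fun w : ℂ => (Complex.I - starRingEnd ℂ Complex.I) * (w * star w)) R =
      (Complex.I - starRingEnd ℂ Complex.I) • (R * star R) := by
    rw [cfc_const_mul .., cfc_mul .., cfc_id' ℂ R, cfc_star_id (R := ℂ) (a := R)]
  rw [← h1, ← h2] at h
  intro w hw hw0
  have key : w - star w = (Complex.I - starRingEnd ℂ Complex.I) * (w * star w) :=
    eqOn_of_cfc_eq_cfc h (by fun_prop) (by fun_prop) hn hw
  have him := congrArg Complex.im key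
  simp only [Complex.star_def, Complex.mul_conj, Complex.conj_I, sub_neg_eq_add] at him
  simp [Complex.normSq_apply] at him
  rw [Complex.inv_im, div_eq_iff (by simpa using hw0), Complex.normSq_apply]
  linarith

theorem continuousOn_pullback_spectrum (hA : IsSelfAdjoint A) {g : ℝ → ℂ}
    (hg : VanishesAtInfinity g) :
    ContinuousOn (pullback g) (spectrum ℂ (resolventCLM A Complex.I)) :=
  (continuousOn_pullback hg).mono (spectrum_resolventCLM_subset hA)

theorem vanishingCalculus_mul (hA : IsSelfAdjoint A) {g h : ℝ → ℂ} (hg : VanishesAtInfinity g)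
    (hh : VanishesAtInfinity h) :
    vanishingCalculus A (fun t => g t * h t) = vanishingCalculus A g * vanishingCalculus A h := by
  rw [vanishingCalculus, vanishingCalculus, vanishingCalculus,
    ← cfc_mul _ _ _ (continuousOn_pullback_spectrum hA hg) (continuousOn_pullback_spectrum hA hh)]
  congr 1
  ext w
  by_cases hw : w = 0 <;> simp [pullback, hw]

theorem vanishingCalculus_sub (hA : IsSelfAdjoint A) {g h : ℝ → ℂ} (hg : VanishesAtInfinity g)
    (hh : VanishesAtInfinity h) :
    vanishingCalculus A (fun t => g t - h t) = vanishingCalculus A g - vanishingCalculus A h := by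
  rw [vanishingCalculus, vanishingCalculus, vanishingCalculus,
    ← cfc_sub _ _ _ (continuousOn_pullback_spectrum hA hg) (continuousOn_pullback_spectrum hA hh)]
  congr 1
  ext w
  by_cases hw : w = 0 <;> simp [pullback, hw]

theorem norm_vanishingCalculus_le (A : H →ₗ.[ℂ] H) {g : ℝ → ℂ} {K : ℝ}
    (hK : ∀ t, ‖g t‖ ≤ K) : ‖vanishingCalculus A g‖ ≤ K := by
  have hK0 : 0 ≤ K := (norm_nonneg _).trans (hK 0)
  refine norm_cfc_le hK0 fun w _ => ?_
  by_cases hw : w = 0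
  · simpa [hw, pullback_zero] using hK0
  · rw [pullback_of_ne hw]
    exact hK _

theorem continuous_cutoff (n : ℕ) : Continuous (cutoff n) := by
  unfold cutoff
  fun_prop

theorem cutoff_nonneg (n : ℕ) (t : ℝ) : 0 ≤ cutoff n t := le_max_left _ _

theorem cutoff_le_one (n : ℕ) (t : ℝ) : cutoff n t ≤ 1 :=
  max_le zero_le_one (min_le_left _ _)

theorem cutoff_eq_one {n : ℕ} {t : ℝ} (h : |t| ≤ n) : cutoff n t = 1 := by
  rw [cutoff, min_eq_left (by linarith), max_eq_right zero_le_one]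

theorem cutoff_eq_zero {n : ℕ} {t : ℝ} (h : n + 1 ≤ |t|) : cutoff n t = 0 := by
  rw [cutoff, max_eq_left ((min_le_right _ _).trans (by linarith))]

theorem vanishesAtInfinity_cutoff_mul (n : ℕ) {g : ℝ → ℂ} (hg : Continuous g) :
    VanishesAtInfinity fun t => (cutoff n t : ℂ) * g t where
  continuous := (Complex.continuous_ofReal.comp (continuous_cutoff n)).mul hg
  tendsto := by
    refine tendsto_const_nhds.congr' ?_
    have h := tendsto_norm_cocompact_atTop (E := ℝ)
    filter_upwards [h.eventually_ge_atTop ((n : ℝ) + 1)] with t ht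
    rw [cutoff_eq_zero ht]
    simp

/-- Convergence is in operator norm: the error is controlled by the size of `g` on $|t|>n$. -/
theorem tendsto_vanishingCalculus_cutoff (hA : IsSelfAdjoint A) {g : ℝ → ℂ}
    (hg : VanishesAtInfinity g) :
    Tendsto (fun n : ℕ => vanishingCalculus A fun t => (cutoff n t : ℂ) * g t) atTop
      (𝓝 (vanishingCalculus A g)) := by
  rw [Metric.tendsto_atTop]
  intro ε hε
  obtain ⟨N, hN⟩ := hg.exists_norm_le (half_pos hε)
  obtain ⟨n₀, hn₀⟩ := exists_nat_gt N
  refine ⟨n₀, fun n hn => ?_⟩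
  rw [dist_eq_norm, ← vanishingCalculus_sub hA (vanishesAtInfinity_cutoff_mul n hg.continuous) hg]
  refine (norm_vanishingCalculus_le A (K := ε / 2) fun t => ?_).trans_lt (half_lt_self hε)
  rcases le_or_gt |t| n with ht | ht
  · rw [cutoff_eq_one ht]
    simpa using (half_pos hε).le
  · have h1 : (n₀ : ℝ) ≤ n := by exact_mod_cast hn
    have h2 : ‖(cutoff n t : ℂ) * g t - g t‖ = (1 - cutoff n t) * ‖g t‖ := by
      rw [← sub_one_mul, norm_mul, ← Complex.ofReal_one, ← Complex.ofReal_sub, Complex.norm_real,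
        Real.norm_eq_abs, abs_sub_comm, abs_of_nonneg (sub_nonneg.2 (cutoff_le_one n t))]
    rw [h2]
    have h3 := hN t (by linarith)
    nlinarith [cutoff_nonneg n t, norm_nonneg (g t)]

theorem vanishingCalculus_inv_sub (hA : IsSelfAdjoint A) {z : ℂ} (hz : z.im ≠ 0) :
    vanishingCalculus A (fun t : ℝ => ((t : ℂ) - z)⁻¹) = resolventCLM A z := by
  have hI : Complex.I.im ≠ 0 := by simp
  have hn := isStarNormal_resolventCLM hA hI
  have hcont := continuousOn_pullback_spectrum hA (decaying_inv_sub hz).vanishesAtInfinity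
  have hspec := spectrum_resolventCLM_subset hA
  have h1 := resolventCLM_sub hA hI hz
  have h2 := resolventCLM_sub hA hz hI
  rw [vanishingCalculus]
  set R := resolventCLM A Complex.I
  set S := resolventCLM A z
  set T := cfc (pullback fun t : ℝ => ((t : ℂ) - z)⁻¹) R with hT
  -- The scalar identity $(t-i)^{-1}-(t-z)^{-1}=(i-z)(t-i)^{-1}(t-z)^{-1}$ transported by the
  -- calculus: $T$ obeys the same equation as $S$.
  have key : R - T = (Complex.I - z) • (R * T) := by
    have h3 : cfc (fun w : ℂ => w - pullback (fun t : ℝ => ((t : ℂ) - z)⁻¹) w) R = R - T := by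
      rw [cfc_sub _ _ R (by fun_prop) hcont, cfc_id' ℂ R]
    have h4 : cfc (fun w : ℂ => (Complex.I - z) *
        (w * pullback (fun t : ℝ => ((t : ℂ) - z)⁻¹) w)) R = (Complex.I - z) • (R * T) := by
      rw [cfc_const_mul _ (fun w => w * pullback _ w) R ((continuousOn_id' _).mul hcont),
        cfc_mul (fun w : ℂ => w) _ R (by fun_prop) hcont, cfc_id' ℂ R]
    rw [← h3, ← h4]
    refine cfc_congr fun w hw => ?_
    by_cases h0 : w = 0
    · simp [h0, pullback_zero]
    · have h5 : w⁻¹ = ((w⁻¹).re : ℂ) - Complex.I := by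
        apply Complex.ext
        · simp
        · rw [hspec hw h0]
          simp
      simp only [pullback_of_ne h0]
      have h6 : ((w⁻¹).re : ℂ) - z ≠ 0 := norm_pos_iff.1 (norm_sub_pos hz _)
      have h7 : w * (((w⁻¹).re : ℂ) - Complex.I) = 1 := by rw [← h5, mul_inv_cancel₀ h0]
      set t := (w⁻¹).re
      field_simp
      linear_combination h7
  have h3 : S - T = (z - Complex.I) • (R * (S - T)) := by
    calc S - T = (R - T) - (R - S) := by abel
      _ = (z - Complex.I) • (R * (S - T)) := by
        rw [key, h1, mul_sub]
        module
  -- With $D=S-T=(z-i)RD$, one gets $SD=(z-i)SRD=(S-R)D$, hence $RD=0$ and then $D=0$.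
  have h4 : R * (S - T) = 0 := by
    have h5 : S * (S - T) = S * (S - T) - R * (S - T) := by
      calc S * (S - T) = (z - Complex.I) • (S * R) * (S - T) := by
            conv_lhs => rw [h3]
            rw [mul_smul_comm, smul_mul_assoc, mul_assoc]
        _ = _ := by rw [← h2, sub_mul]
    exact sub_eq_self.1 h5.symm
  rw [h4, smul_zero] at h3
  exact (sub_eq_zero.1 h3).symm

end VanishingCalculus

/-! ### Unbounded functions of a self-adjoint operator -/

section Represents

variable {H : Type*} [NormedAddCommGroup H] [InnerProductSpace ℂ H] [CompleteSpace H]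
  {A : H →ₗ.[ℂ] H}

theorem mem_graph_functionalCalculus {f : ℝ → ℝ} {ψ η : H} :
    (ψ, η) ∈ (functionalCalculus A f).graph ↔
      Tendsto (fun n : ℕ => compactCalculus A (fun t => cutoff n t * f t) ψ) atTop (𝓝 η) := by
  rw [LinearPMap.mem_graph_iff]
  constructor
  · rintro ⟨x, rfl, rfl⟩
    exact x.2.choose_spec
  · intro h
    let x : (functionalCalculus A f).domain := ⟨ψ, η, h⟩
    exact ⟨x, rfl, tendsto_nhds_unique x.2.choose_spec h⟩

theorem compactCalculus_cutoff_mul (hA : IsSelfAdjoint A) {f : ℝ → ℝ} (hf : Continuous f)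
    {h : ℝ → ℂ} (hh : VanishesAtInfinity h) (n : ℕ) :
    compactCalculus A (fun t => cutoff n t * f t) * vanishingCalculus A h =
      vanishingCalculus A fun t => (cutoff n t : ℂ) * (h t * f t) := by
  have hc := vanishesAtInfinity_cutoff_mul n (Complex.continuous_ofReal.comp hf)
  have heq : compactCalculus A (fun t => cutoff n t * f t) =
      vanishingCalculus A fun t => (cutoff n t : ℂ) * (Complex.ofReal ∘ f) t := by
    rw [compactCalculus_eq]
    simp
  rw [heq, ← vanishingCalculus_mul hA hc hh]
  congr 1
  ext t
  simp only [Function.comp_apply]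
  ring

theorem vanishingCalculus_mem_graph (hA : IsSelfAdjoint A) {f : ℝ → ℝ} (hf : Continuous f)
    {h : ℝ → ℂ} (hh : VanishesAtInfinity h) (hhf : VanishesAtInfinity fun t => h t * f t) (ψ : H) :
    (vanishingCalculus A h ψ, vanishingCalculus A (fun t => h t * f t) ψ) ∈
      (functionalCalculus A f).graph := by
  rw [mem_graph_functionalCalculus]
  simp_rw [← mul_apply_eq_comp, compactCalculus_cutoff_mul hA hf hh]
  exact ((ContinuousLinearMap.apply ℂ H ψ).continuous.tendsto _).comp
    (tendsto_vanishingCalculus_cutoff hA hhf)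

/-- The truncations $(\chi_nf)(A)$ commute with $h(A)$, so $h(A)$ can be moved inside the limit
defining $f(A)\psi$. -/
theorem vanishingCalculus_apply_of_mem_graph (hA : IsSelfAdjoint A) {f : ℝ → ℝ}
    (hf : Continuous f) {h : ℝ → ℂ} (hh : VanishesAtInfinity h)
    (hhf : VanishesAtInfinity fun t => h t * f t) {ψ η : H}
    (hψ : (ψ, η) ∈ (functionalCalculus A f).graph) :
    vanishingCalculus A h η = vanishingCalculus A (fun t => h t * f t) ψ := by
  rw [mem_graph_functionalCalculus] at hψ
  refine tendsto_nhds_unique (((vanishingCalculus A h).continuous.tendsto _).comp hψ) ?_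
  have key : ∀ n : ℕ, vanishingCalculus A h (compactCalculus A (fun t => cutoff n t * f t) ψ) =
      vanishingCalculus A (fun t => (cutoff n t : ℂ) * (h t * f t)) ψ := by
    intro n
    have hcomm : Commute (vanishingCalculus A h)
        (compactCalculus A fun t => cutoff n t * f t) := cfc_commute_cfc _ _ _
    rw [← mul_apply_eq_comp, hcomm.eq, compactCalculus_cutoff_mul hA hf hh]
  simp only [Function.comp_def, key]
  exact ((ContinuousLinearMap.apply ℂ H ψ).continuous.tendsto _).comp
    (tendsto_vanishingCalculus_cutoff hA hhf)

/-- `T` acts as multiplication by the slowly growing function `f` with respect to the functional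
calculus of `A`, applied to decaying functions. -/
structure Represents (A T : H →ₗ.[ℂ] H) (f : ℝ → ℝ) : Prop where
  slowlyGrowing : SlowlyGrowing f
  mem_graph : ∀ h, Decaying h → ∀ ψ,
    (vanishingCalculus A h ψ, vanishingCalculus A (fun t => h t * f t) ψ) ∈ T.graph
  apply_of_mem_graph : ∀ h, Decaying h → ∀ ψ η, (ψ, η) ∈ T.graph →
    vanishingCalculus A h η = vanishingCalculus A (fun t => h t * f t) ψ

theorem represents_functionalCalculus (hA : IsSelfAdjoint A) {f : ℝ → ℝ} (hf : SlowlyGrowing f) :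
    Represents A (functionalCalculus A f) f where
  slowlyGrowing := hf
  mem_graph _ hh ψ := vanishingCalculus_mem_graph hA hf.continuous hh.vanishesAtInfinity
    (hh.mul hf).vanishesAtInfinity ψ
  apply_of_mem_graph _ hh _ _ := vanishingCalculus_apply_of_mem_graph hA hf.continuous
    hh.vanishesAtInfinity (hh.mul hf).vanishesAtInfinity

theorem Represents.opMul {S T : H →ₗ.[ℂ] H} {f g : ℝ → ℝ} (hS : Represents A S g)
    (hT : Represents A T f) : Represents A (opMul S T) fun t => g t * f t where
  slowlyGrowing := hS.slowlyGrowing.mul hT.slowlyGrowing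
  mem_graph h hh ψ := by
    refine mem_graph_opMul.2 ⟨_, hT.mem_graph h hh ψ, ?_⟩
    have heq : (fun t => h t * ((g t * f t : ℝ) : ℂ)) = fun t => h t * (f t : ℂ) * (g t : ℂ) := by
      ext t
      push_cast
      ring
    rw [heq]
    exact hS.mem_graph _ (hh.mul hT.slowlyGrowing) ψ
  apply_of_mem_graph h hh ψ η hψ := by
    obtain ⟨θ, h1, h2⟩ := mem_graph_opMul.1 hψ
    rw [hS.apply_of_mem_graph h hh _ _ h2,
      hT.apply_of_mem_graph _ (hh.mul hS.slowlyGrowing) _ _ h1]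
    congr 2
    ext t
    push_cast
    ring

theorem represents_iterLogPow (hA : IsSelfAdjoint A) (k : ℕ) (p : ℝ) :
    Represents A (iterLogPow A k p) fun t => iterLog k (bracket t) ^ p :=
  represents_functionalCalculus hA ((slowlyVarying_iterLog k).rpow p).slowlyGrowing

theorem represents_iterLogProd (hA : IsSelfAdjoint A) (q : ℝ) (m : ℕ) :
    Represents A (iterLogProd A q m)
      fun t => ∏ k ∈ Finset.range (m + 1), iterLog k (bracket t) ^ q := by
  induction m with
  | zero =>
    simp only [zero_add, Finset.prod_range_one]
    exact represents_iterLogPow hA 0 q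
  | succ m ih =>
    simp_rw [Finset.prod_range_succ _ (m + 1)]
    exact ih.opMul (represents_iterLogPow hA (m + 1) q)

/-- The power $\langle t\rangle^s$ is not slowly growing, so `Represents` does not cover it; $s<1$
lets the resolvent absorb it. -/
theorem bracketPow_resolvent_mem_graph (hA : IsSelfAdjoint A) {s : ℝ} (hs : s < 1) {z : ℂ}
    (hz : z.im ≠ 0) (ψ : H) :
    (ψ, vanishingCalculus A (fun t => ((t : ℂ) - z)⁻¹ * ((bracket t ^ s : ℝ) : ℂ)) ψ) ∈
      (opMul (bracketPow A s) (resolvent A z)).graph := by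
  refine mem_graph_opMul.2 ⟨_, (mem_graph_resolvent_iff hA hz).2 rfl, ?_⟩
  rw [← vanishingCalculus_inv_sub hA hz]
  exact vanishingCalculus_mem_graph hA
    (continuous_bracket.rpow_const fun t => Or.inl (bracket_pos t).ne')
    (decaying_inv_sub hz).vanishesAtInfinity (decaying_bracket_rpow_div hs hz).vanishesAtInfinity ψ

/-- A slowly varying weight of `A`, applied after `⟨A⟩^s (A - z)⁻¹`. -/
theorem Represents.mem_graph_opMul_left (hA : IsSelfAdjoint A) {T : H →ₗ.[ℂ] H} {f : ℝ → ℝ}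
    (hT : Represents A T f) {s : ℝ} (hs : s < 1) {z : ℂ} (hz : z.im ≠ 0) (ψ : H) :
    (ψ, vanishingCalculus A
        (fun t => ((t : ℂ) - z)⁻¹ * ((bracket t ^ s : ℝ) : ℂ) * (f t : ℂ)) ψ) ∈
      (LogResolvent.opMul T (LogResolvent.opMul (bracketPow A s) (resolvent A z))).graph :=
  mem_graph_opMul.2 ⟨_, bracketPow_resolvent_mem_graph hA hs hz ψ,
    hT.mem_graph _ (decaying_bracket_rpow_div hs hz) ψ⟩

/-- A slowly varying weight of `A`, applied before `⟨A⟩^s (A - z)⁻¹`. -/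
theorem Represents.eq_of_mem_graph_opMul_right (hA : IsSelfAdjoint A) {T : H →ₗ.[ℂ] H}
    {f : ℝ → ℝ} (hT : Represents A T f) {s : ℝ} (hs : s < 1) {z : ℂ} (hz : z.im ≠ 0) {ψ η : H}
    (h : (ψ, η) ∈
      (LogResolvent.opMul (bracketPow A s) (LogResolvent.opMul (resolvent A z) T)).graph) :
    η = vanishingCalculus A
      (fun t => ((t : ℂ) - z)⁻¹ * ((bracket t ^ s : ℝ) : ℂ) * (f t : ℂ)) ψ := by
  obtain ⟨φ, h1, h2⟩ := mem_graph_opMul.1 h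
  obtain ⟨θ, h3, h4⟩ := mem_graph_opMul.1 h1
  -- With $\theta=T\psi$, the right side becomes $h(A)\theta$ for $h(t)=(t-z)^{-1}\langle
  -- t\rangle^s$, which is $\langle A\rangle^s(A-z)^{-1}\theta$.
  rw [← hT.apply_of_mem_graph _ (decaying_bracket_rpow_div hs hz) _ _ h3]
  exact LinearPMap.mem_graph_snd_inj _ (mem_graph_opMul.2 ⟨φ, h4, h2⟩)
    (bracketPow_resolvent_mem_graph hA hs hz θ) rfl

/-- Since $(t-i)^{-1}$ decays, $T$ is defined on the range of $(A-i)^{-1}$, and $\langle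
A\rangle^s(A-z)^{-1}$ is defined everywhere. -/
theorem Represents.exists_mem_graph_opMul_right (hA : IsSelfAdjoint A) {T : H →ₗ.[ℂ] H}
    {f : ℝ → ℝ} (hT : Represents A T f) {s : ℝ} (hs : s < 1) {z : ℂ} (hz : z.im ≠ 0) {ψ : H}
    (hψ : ψ ∈ Set.range (resolventCLM A Complex.I)) : ∃ η, (ψ, η) ∈
      (LogResolvent.opMul (bracketPow A s) (LogResolvent.opMul (resolvent A z) T)).graph := by
  obtain ⟨θ, rfl⟩ := hψ
  have hI : Complex.I.im ≠ 0 := by simp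
  rw [← vanishingCalculus_inv_sub hA hI]
  have h1 := hT.mem_graph _ (decaying_inv_sub hI) θ
  obtain ⟨φ, h2, h3⟩ := mem_graph_opMul.1 (bracketPow_resolvent_mem_graph hA hs hz
    (vanishingCalculus A (fun t : ℝ => ((t : ℂ) - Complex.I)⁻¹ * (f t : ℂ)) θ))
  exact ⟨_, mem_graph_opMul.2 ⟨φ, mem_graph_opMul.2 ⟨_, h1, h2⟩, h3⟩⟩

end Represents

end LogResolvent

end


theorem lemma4p10 {H : Type*} [NormedAddCommGroup H] [InnerProductSpace ℂ H] [CompleteSpace H]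
    (A : H →ₗ.[ℂ] H) (hA : IsSelfAdjoint A) (c : ℝ) (hc : 0 < c) (s : ℝ) (hs0 : 0 < s)
    (hs1 : s < 1) :
    -- the bound with the weight `log^p (1 + ⟨A⟩) ⟨A⟩^s`, for an everywhere defined operator
    (∀ p : ℝ, ∃ C : ℝ, 0 < C ∧ ∀ x y : ℝ, 0 < |y| → |y| ≤ c * LogResolvent.bracket x →
      (LogResolvent.opMul (LogResolvent.logPow A p) (LogResolvent.opMul
          (LogResolvent.bracketPow A s) (LogResolvent.resolvent A ⟨x, y⟩))).domain = ⊤ ∧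
      LogResolvent.OpNormLE
        (LogResolvent.opMul (LogResolvent.logPow A p) (LogResolvent.opMul
          (LogResolvent.bracketPow A s) (LogResolvent.resolvent A ⟨x, y⟩)))
        (C * Real.log (1 + LogResolvent.bracket x) ^ p * LogResolvent.bracket x ^ s * |y|⁻¹)) ∧
    -- the bound with iterated logarithms
    (∀ (m : ℕ) (p q : ℝ), ∃ C : ℝ, 0 < C ∧ ∀ x y : ℝ, 0 < |y| →
      |y| ≤ c * LogResolvent.bracket x →
      LogResolvent.OpNormLE
        (LogResolvent.opMul (LogResolvent.bracketPow A s) (LogResolvent.opMul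
          (LogResolvent.resolvent A ⟨x, y⟩) (LogResolvent.opMul
            (LogResolvent.iterLogPow A (m + 1) p) (LogResolvent.iterLogProd A q m))))
        (C * LogResolvent.bracket x ^ s * |y|⁻¹ *
          LogResolvent.iterLog (m + 1) (LogResolvent.bracket x) ^ p *
          ∏ k ∈ Finset.range (m + 1), LogResolvent.iterLog k (LogResolvent.bracket x) ^ q)) := by
  open LogResolvent in
  refine ⟨fun p => ?_, fun m p q => ?_⟩
  -- As $\log_1(u)=\log(1+u)$, the operator `logPow A p` is `iterLogPow A 1 p` by unfolding.
  · obtain ⟨C, hC, hle⟩ := ((slowlyVarying_iterLog 1).rpow p).norm_div_le hs0 hs1 hc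
    refine ⟨C, hC, fun x y hy hyc => ?_⟩
    have hmem := (represents_iterLogPow hA 1 p).mem_graph_opMul_left hA hs1
      (z := ⟨x, y⟩) (abs_pos.1 hy)
    refine ⟨eq_top_iff.2 fun ψ _ => LinearPMap.mem_domain_of_mem_graph (hmem ψ),
      opNormLE_of_graph dense_univ (fun ψ _ => ⟨_, hmem ψ⟩) fun ψ η h => ?_⟩
    rw [LinearPMap.mem_graph_snd_inj _ h (hmem ψ) rfl]
    refine (ContinuousLinearMap.le_of_opNorm_le _
      (norm_vanishingCalculus_le A (hle ⟨x, y⟩ hy hyc)) ψ).trans_eq ?_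
    simp only [iterLog]
    ring
  · have hslow := ((slowlyVarying_iterLog (m + 1)).rpow p).mul
      (SlowlyVarying.prod (Finset.range (m + 1)) fun k => (slowlyVarying_iterLog k).rpow q)
    obtain ⟨C, hC, hle⟩ := hslow.norm_div_le hs0 hs1 hc
    refine ⟨C, hC, fun x y hy hyc => ?_⟩
    have hT := (represents_iterLogPow hA (m + 1) p).opMul (represents_iterLogProd hA q m)
    have hz : Complex.im ⟨x, y⟩ ≠ 0 := abs_pos.1 hy
    refine opNormLE_of_graph (dense_range_resolventCLM hA (z := Complex.I) (by simp))
      (fun ψ hψ => hT.exists_mem_graph_opMul_right hA hs1 hz hψ) fun ψ η h => ?_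
    rw [hT.eq_of_mem_graph_opMul_right hA hs1 hz h]
    refine (ContinuousLinearMap.le_of_opNorm_le _
      (norm_vanishingCalculus_le A (hle ⟨x, y⟩ hy hyc)) ψ).trans_eq ?_
    ring
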